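/- Let $R>r>0$ be real numbers, let $c_0=\log\left(\frac{R^2+r^2}{2rR}\right)$, and let $\delta$ be a real number with $\delta>2(6/c_0)^2$. Let $f$ be a complex-valued function that is analytic on the open disc $|z|<R$, continuous on the closed disc $|z|\le R$, and transcendental over $\mathbf{C}(z)$, that is, no nonzero polynomial $P\in\mathbf{C}[X,Y]$ satisfies $P(z,f(z))=0$ for all $z$ with $|z|\le R$. For an integer $D\ge 1$ and a real number $N\ge 0$, let $\Sigma_{D,N}$ be the set of algebraic numbers $\alpha\in\mathbf{C}$ with $|\alpha|\le r$ such that $f(\alpha)$ is algebraic, $[\mathbf{Q}(\alpha,f(\alpha)):\mathbf{Q}]\le D$, $h(\alpha)\le N$ and $h(f(\alpha))\le N$, where $h$ denotes the absolute logarithmic (Weil) height of an algebraic number. (i) For every integer $D\ge 1$ there is a sequence of real numbers $N\ge 0$ tending to infinity for which $\Sigma_{D,N}$ is finite and $\mathrm{Card}(\Sigma_{D,N})<\delta D^3N^2$. (ii) For every real number $N>0$ there is a sequence of integers $D\ge 2$ tending to infinity for which $\Sigma_{D,N}$ is finite and $\mathrm{Card}(\Sigma_{D,N})<\delta D^3N^2$.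 -/

import Mathlib

/-- `f` is transcendental over `ℂ(z)` as a function on `U`: no nonzero polynomial in two variables
with complex coefficients vanishes at all the points `(z, f z)`, `z ∈ U`. -/
def TranscendentalFunOn (f : ℂ → ℂ) (U : Set ℂ) : Prop :=
  ¬ ∃ P : MvPolynomial (Fin 2) ℂ, P ≠ 0 ∧ ∀ z ∈ U, MvPolynomial.eval ![z, f z] P = 0

/-- The set `Σ_{D,N}(f,r)` of algebraic numbers `α` with `|α| ≤ r` such that `f α` is algebraic,
`[ℚ(α, f α) : ℚ] ≤ D`, and the absolute logarithmic heights of `α` and `f α` are at most `N`. -/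
def algPoints (f : ℂ → ℂ) (r : ℝ) (D : ℕ) (N : ℝ) : Set ℂ :=
  {α : ℂ | ‖α‖ ≤ r ∧ IsAlgebraic ℚ α ∧ IsAlgebraic ℚ (f α) ∧
    Module.finrank ℚ (IntermediateField.adjoin ℚ ({α, f α} : Set ℂ)) ≤ D ∧
    NumberField.absLogHeight₁ α ≤ N ∧ NumberField.absLogHeight₁ (f α) ≤ N}

/-! Suppose the bound fails for all large heights (or degrees). Fix one of the two parameters and
let the other grow by 1 at each step from a large start; this gives pairs (D_k, N_k) and sets S_k of
exactly ⌈δ D_k³ N_k²⌉ points. Siegel's lemma (`exists_bipoly_vanishing`), a pigeonhole on values in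
number fields of degree at most D_0, gives a nonzero integer polynomial P with partial degrees below
L ≈ √(2δ) D_0² N_0 and coefficients of logarithmic size about 2 L N_0, such that F(z) = P(z, f(z))
vanishes on S_0. If F vanishes on S_k, the Schwarz lemma (`norm_le_of_vanish_on_finset`) gains a
factor exp(-c₀ |S_k|) on |z| ≤ r, while Liouville's inequality (`one_le_norm_bipolyVal_mul`) bounds
any nonzero value of F on S_{k+1} from below. These are incompatible, so F vanishes on S_{k+1}, and
by induction on every S_k (`false_of_extrapolation`). Since |S_k| tends to infinity, this
contradicts the finiteness of the zeros of F (`finite_zeros_bipolyVal`), where transcendence enters.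
The incompatibility is numerical: up to lower-order terms the arithmetic cost is at most 6 L D_k N_k
≈ 6√(2δ) D_0² N_0 D_k N_k, against an analytic gain of c₀ δ D_k³ N_k². It suffices that 6√(2δ) < c₀
δ, that is, δ > 2(6/c₀)². -/

/-! ### Schwarz lemma with several zeros -/

open Metric in
/-- Factoring out a Blaschke factor does not increase the sup norm. -/
theorem exists_blaschke_factor {F : ℂ → ℂ} {R M : ℝ} (hR : 0 < R)
    (hF : DiffContOnCl ℂ F (ball 0 R)) (hM : ∀ z ∈ closedBall (0 : ℂ) R, ‖F z‖ ≤ M)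
    {w : ℂ} (hw : w ∈ ball (0 : ℂ) R) (hFw : F w = 0) :
    ∃ G : ℂ → ℂ, DiffContOnCl ℂ G (ball 0 R) ∧ (∀ z ∈ closedBall (0 : ℂ) R, ‖G z‖ ≤ M) ∧
      ∀ z, F z * (R ^ 2 - starRingEnd ℂ w * z) = G z * (R * (z - w)) := by
  have hRc : (R : ℂ) ≠ 0 := by exact_mod_cast hR.ne'
  have hd : DifferentiableAt ℂ F w :=
    hF.differentiableOn.differentiableAt (isOpen_ball.mem_nhds hw)
  have hnhds : closedBall (0 : ℂ) R ∈ nhds w :=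
    Filter.mem_of_superset (isOpen_ball.mem_nhds hw) ball_subset_closedBall
  have hid : ∀ z, F z = (z - w) * dslope F w z := by
    intro z
    have := sub_smul_dslope F w z
    rw [hFw, sub_zero, smul_eq_mul] at this
    exact this.symm
  have hdc : DiffContOnCl ℂ (dslope F w) (ball 0 R) := by
    refine ⟨(Complex.differentiableOn_dslope (isOpen_ball.mem_nhds hw)).2 hF.differentiableOn, ?_⟩
    rw [closure_ball _ hR.ne']
    refine (continuousOn_dslope hnhds).2 ⟨?_, hd⟩
    have := hF.continuousOn
    rwa [closure_ball _ hR.ne'] at this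
  -- The Blaschke factor R(z - w)/(R² - w̄z) has modulus 1 on |z| = R, so |G| = |F| there and the
  -- maximum principle carries the bound inside.
  let G : ℂ → ℂ := fun z => dslope F w z * ((R ^ 2 - starRingEnd ℂ w * z) / R)
  have hG : DiffContOnCl ℂ G (ball 0 R) := by
    have h2 : Differentiable ℂ fun z : ℂ => (R ^ 2 - starRingEnd ℂ w * z) / (R : ℂ) := by
      fun_prop
    exact hdc.smul h2.diffContOnCl
  have hfac : ∀ z, F z * (R ^ 2 - starRingEnd ℂ w * z) = G z * (R * (z - w)) := by
    intro z
    simp only [G]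
    rw [hid z]
    field_simp
  refine ⟨G, hG, ?_, hfac⟩
  have hfr : ∀ z ∈ frontier (ball (0 : ℂ) R), ‖G z‖ ≤ M := by
    intro z hz
    rw [frontier_ball _ hR.ne', mem_sphere_zero_iff_norm] at hz
    have hne : z - w ≠ 0 := by
      intro h
      rw [sub_eq_zero] at h
      rw [mem_ball_zero_iff, ← h] at hw
      linarith
    have hconj : (R : ℂ) ^ 2 - starRingEnd ℂ w * z = z * starRingEnd ℂ (z - w) := by
      have : z * starRingEnd ℂ z = (R : ℂ) ^ 2 := by
        rw [Complex.mul_conj, Complex.normSq_eq_norm_sq, hz]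
        push_cast
        ring
      rw [map_sub, mul_sub, this]
      ring
    have h1 := congrArg norm (hfac z)
    rw [hconj] at h1
    simp only [norm_mul, RCLike.norm_conj, hz, Complex.norm_real, Real.norm_eq_abs,
      abs_of_pos hR] at h1
    have h2 : ‖G z‖ = ‖F z‖ :=
      (mul_right_cancel₀ (mul_pos hR (norm_pos_iff.2 hne)).ne' h1).symm
    rw [h2]
    exact hM z (mem_closedBall_zero_iff.2 hz.le)
  intro z hz
  rw [← closure_ball _ hR.ne'] at hz
  exact Complex.norm_le_of_forall_mem_frontier_norm_le isBounded_ball hG hfr hz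

/-- The pseudo-hyperbolic distance of two points of a disc of radius `r` in a disc of radius `R`. -/
theorem norm_blaschke_le {R r : ℝ} (hr : 0 < r) (hR : r < R) {z w : ℂ} (hz : ‖z‖ ≤ r)
    (hw : ‖w‖ ≤ r) :
    ‖(R : ℂ) * (z - w)‖ ≤ 2 * r * R / (R ^ 2 + r ^ 2) *
      ‖(R : ℂ) ^ 2 - starRingEnd ℂ w * z‖ := by
  have hR0 : 0 < R := hr.trans hR
  set t := (starRingEnd ℂ w * z).re with ht
  have h1 : ‖z - w‖ ^ 2 = ‖z‖ ^ 2 + ‖w‖ ^ 2 - 2 * t := by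
    rw [← Complex.normSq_eq_norm_sq, ← Complex.normSq_eq_norm_sq, ← Complex.normSq_eq_norm_sq, ht]
    simp [Complex.normSq_apply]
    ring
  have h2 : ‖(R : ℂ) ^ 2 - starRingEnd ℂ w * z‖ ^ 2 = R ^ 4 - 2 * R ^ 2 * t + ‖z‖ ^ 2 * ‖w‖ ^ 2 := by
    rw [← Complex.normSq_eq_norm_sq, ← Complex.normSq_eq_norm_sq, ← Complex.normSq_eq_norm_sq, ht]
    simp [Complex.normSq_apply, pow_two]
    ring
  have h3 : -(‖z‖ * ‖w‖) ≤ t := by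
    have := (abs_le.1 (Complex.abs_re_le_norm (starRingEnd ℂ w * z))).1
    rw [norm_mul, RCLike.norm_conj] at this
    linarith
  have hz0 := norm_nonneg z
  have hw0 := norm_nonneg w
  rw [div_mul_eq_mul_div, le_div_iff₀ (by positivity), norm_mul, Complex.norm_real,
    Real.norm_eq_abs, abs_of_pos hR0]
  have key : ‖z - w‖ * (R ^ 2 + r ^ 2) ≤ 2 * r * ‖(R : ℂ) ^ 2 - starRingEnd ℂ w * z‖ := by
    refine le_of_sq_le_sq ?_ (by positivity)
    rw [mul_pow, mul_pow, h1, h2]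
    generalize ‖z‖ = a at *
    generalize ‖w‖ = b at *
    -- The difference of the two sides is affine in t with slope 2(R² - r²)², so the worst case is t
    -- = -ab (opposite directions), which is the square of `e2`.
    have e1 : 0 ≤ (R ^ 2 - r ^ 2) ^ 2 * (t + a * b) := by
      have : 0 ≤ t + a * b := by linarith
      positivity
    have e2 : (a + b) * (R ^ 2 + r ^ 2) ≤ 2 * r * (R ^ 2 + a * b) := by
      have e3 : 0 ≤ (r - a) * (R ^ 2 - r * b) :=
        mul_nonneg (by linarith) (by nlinarith)
      have e4 : 0 ≤ (r - b) * (R ^ 2 - r * a) :=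
        mul_nonneg (by linarith) (by nlinarith)
      nlinarith
    have e5 := pow_le_pow_left₀ (by positivity) e2 2
    nlinarith
  nlinarith

open Metric in
/-- **Schwarz lemma** for a function vanishing at finitely many points of a smaller disc. -/
theorem norm_le_of_vanish_on_finset {R r : ℝ} (hr : 0 < r) (hR : r < R) (S : Finset ℂ)
    (hS : ∀ w ∈ S, ‖w‖ ≤ r) {F : ℂ → ℂ} {M : ℝ} (hF : DiffContOnCl ℂ F (ball 0 R))
    (hM : ∀ z ∈ closedBall (0 : ℂ) R, ‖F z‖ ≤ M) (hFS : ∀ w ∈ S, F w = 0)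
    {z : ℂ} (hz : ‖z‖ ≤ r) :
    ‖F z‖ ≤ M * (2 * r * R / (R ^ 2 + r ^ 2)) ^ S.card := by
  classical
  have hR0 : 0 < R := hr.trans hR
  induction S using Finset.induction_on generalizing F with
  | empty => simpa using hM z (mem_closedBall_zero_iff.2 (hz.trans hR.le))
  | insert w S hwS ih =>
    have hw : ‖w‖ ≤ r := hS w (Finset.mem_insert_self _ _)
    obtain ⟨G, hG, hGM, hfac⟩ := exists_blaschke_factor hR0 hF hM
      (mem_ball_zero_iff.2 (hw.trans_lt hR)) (hFS w (Finset.mem_insert_self _ _))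
    have hGS : ∀ u ∈ S, G u = 0 := by
      intro u hu
      have h := hfac u
      rw [hFS u (Finset.mem_insert_of_mem hu), zero_mul] at h
      have hne : (R : ℂ) * (u - w) ≠ 0 := by
        refine mul_ne_zero (by exact_mod_cast hR0.ne') (sub_ne_zero.2 ?_)
        rintro rfl
        exact hwS hu
      exact (mul_eq_zero.1 h.symm).resolve_right hne
    have hGz := ih (fun u hu => hS u (Finset.mem_insert_of_mem hu)) hG hGM hGS
    rw [Finset.card_insert_of_notMem hwS, pow_succ]
    have hpos : 0 < ‖(R : ℂ) ^ 2 - starRingEnd ℂ w * z‖ := by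
      rw [norm_pos_iff, sub_ne_zero]
      intro h
      have := congrArg norm h
      simp only [norm_pow, Complex.norm_real, Real.norm_eq_abs, sq_abs, norm_mul,
        RCLike.norm_conj] at this
      nlinarith [norm_nonneg z, norm_nonneg w]
    have h := congrArg norm (hfac z)
    rw [norm_mul, norm_mul (G z)] at h
    have hb := norm_blaschke_le hr hR hz hw
    refine le_of_mul_le_mul_right ?_ hpos
    rw [h]
    calc ‖G z‖ * ‖(R : ℂ) * (z - w)‖ ≤ (M * (2 * r * R / (R ^ 2 + r ^ 2)) ^ S.card) *
          (2 * r * R / (R ^ 2 + r ^ 2) * ‖(R : ℂ) ^ 2 - starRingEnd ℂ w * z‖) :=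
          mul_le_mul hGz hb (norm_nonneg _) ((norm_nonneg _).trans hGz)
      _ = _ := by ring

/-! ### Heights in towers of number fields -/

namespace NumberField

open Height

/-- A place comes from `mult` embeddings, one if real and two if complex. Embeddings are easier than
places to count in a tower. -/
theorem prod_infinitePlace_pow_mult {K M : Type*} [Field K] [NumberField K] [CommMonoid M]
    (g : InfinitePlace K → M) :
    ∏ w, g w ^ w.mult = ∏ φ : K →+* ℂ, g (InfinitePlace.mk φ) := by
  classical
  rw [← Finset.prod_fiberwise Finset.univ InfinitePlace.mk (fun φ => g (InfinitePlace.mk φ))]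
  refine Finset.prod_congr rfl fun w _ => ?_
  rw [Finset.prod_congr rfl (g := fun _ => g w)
    fun φ hφ => by rw [(Finset.mem_filter.mp hφ).2], Finset.prod_const,
    InfinitePlace.card_filter_mk_eq]

section Tower

variable {F K : Type*} [Field F] [NumberField F] [Field K] [NumberField K] [Algebra F K]

open Classical in
theorem card_filter_comp_algebraMap_eq (ψ : F →+* ℂ) :
    (Finset.univ.filter fun φ : K →+* ℂ => φ.comp (algebraMap F K) = ψ).card =
      Module.finrank F K := by
  let : Algebra F ℂ := ψ.toAlgebra
  rw [← AlgHom.card F K ℂ, ← Fintype.card_coe]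
  refine Fintype.card_congr
    { toFun := fun φ => ⟨φ.1, fun x => RingHom.congr_fun (Finset.mem_filter.1 φ.2).2 x⟩
      invFun := fun σ => ⟨σ.toRingHom,
        Finset.mem_filter.2 ⟨Finset.mem_univ _, RingHom.ext fun x => σ.commutes x⟩⟩
      left_inv := fun φ => rfl
      right_inv := fun σ => rfl }

theorem prod_infinitePlace_comap_pow_mult {M : Type*} [CommMonoid M] (g : InfinitePlace F → M) :
    ∏ w : InfinitePlace K, g (w.comap (algebraMap F K)) ^ w.mult =
      (∏ v, g v ^ v.mult) ^ Module.finrank F K := by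
  classical
  rw [prod_infinitePlace_pow_mult (fun w : InfinitePlace K => g (w.comap (algebraMap F K))),
    prod_infinitePlace_pow_mult]
  simp only [InfinitePlace.comap_mk]
  rw [← Finset.prod_fiberwise Finset.univ (fun φ : K →+* ℂ => φ.comp (algebraMap F K)),
    ← Finset.prod_pow]
  refine Finset.prod_congr rfl fun ψ _ => ?_
  rw [Finset.prod_congr rfl (g := fun _ => g (InfinitePlace.mk ψ))
    fun φ hφ => by rw [(Finset.mem_filter.mp hφ).2], Finset.prod_const,
    card_filter_comp_algebraMap_eq]

/-- For integral coordinates the finite part of the height is the inverse norm of the ideal they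
generate, and extending an ideal to K raises its norm to the power [K : F]. No analysis of places of
K above those of F is needed. -/
theorem finprod_finitePlace_algebraMap {ι : Type*} [Finite ι] {x : ι → 𝓞 F} (hx : x ≠ 0) :
    ∏ᶠ w : FinitePlace K, ⨆ i, w (algebraMap F K (x i)) =
      (∏ᶠ v : FinitePlace F, ⨆ i, v (x i)) ^ Module.finrank F K := by
  let y : ι → 𝓞 K := fun i => algebraMap (𝓞 F) (𝓞 K) (x i)
  have hy : y ≠ 0 := by
    obtain ⟨i, hi⟩ := Function.ne_iff.1 hx
    refine Function.ne_iff.2 ⟨i, ?_⟩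
    simpa [y] using hi
  have hF := absNorm_mul_finprod_finitePlace_eq_one hx
  have hK := absNorm_mul_finprod_finitePlace_eq_one hy
  have hspan : Ideal.span (Set.range y) = (Ideal.span (Set.range x)).map (algebraMap (𝓞 F) (𝓞 K)) := by
    rw [Ideal.map_span, ← Set.range_comp]
    rfl
  have hrank : Module.finrank (𝓞 F) (𝓞 K) = Module.finrank F K :=
    (IsFractionRing.finrank_eq (𝓞 F) F (𝓞 K) K).symm
  rw [hspan, Ideal.absNorm_algebraMap, hrank] at hK
  have hne : ((Ideal.span (Set.range x)).absNorm : ℝ) ≠ 0 := left_ne_zero_of_mul_eq_one hF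
  refine mul_left_cancel₀ (pow_ne_zero (Module.finrank F K) hne) ?_
  rw [← mul_pow, hF, one_pow, ← hK]
  push_cast
  rfl

/-- The multiplicative height relative to a number field in a tower of number fields. -/
theorem mulHeight₁_algebraMap (x : F) :
    mulHeight₁ (algebraMap F K x) = mulHeight₁ x ^ Module.finrank F K := by
  -- Clearing denominators writes x as the projective point (a : m) with integral coordinates, as
  -- the ideal argument requires.
  obtain ⟨m, hm, -, hxint⟩ := exists_nat_le_mulHeight₁ x
  obtain ⟨a, ha⟩ : ∃ a : 𝓞 F, (a : F) = m * x := ⟨⟨_, hxint⟩, rfl⟩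
  have hm' : (m : F) ≠ 0 := mod_cast hm
  have hx : x = (a : F) / (m : F) := by rw [ha]; field_simp
  let y : Fin 2 → 𝓞 F := ![a, m]
  have hy : y ≠ 0 := Function.ne_iff.2 ⟨1, by simpa [y] using hm⟩
  have e1 : ![(a : F), (m : F)] = fun i => (y i : F) := by
    ext i; fin_cases i <;> simp [y]
  have e2 : ![algebraMap F K (a : F), algebraMap F K (m : F)] = fun i => algebraMap F K (y i) := by
    ext i; fin_cases i <;> simp [y]
  have hyF : (fun i => (y i : F)) ≠ 0 := by
    rw [← e1]; exact Function.ne_iff.2 ⟨1, by simpa using hm⟩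
  have hyK : (fun i => algebraMap F K (y i)) ≠ 0 := by
    rw [← e2]; exact Function.ne_iff.2 ⟨1, by simpa using hm⟩
  rw [hx, map_div₀, mulHeight₁_div_eq_mulHeight, mulHeight₁_div_eq_mulHeight, e1, e2,
    mulHeight_eq hyF, mulHeight_eq hyK, mul_pow, finprod_finitePlace_algebraMap hy,
    ← prod_infinitePlace_comap_pow_mult]
  rfl

end Tower

/-- The height relative to a number field in terms of the absolute height. -/
theorem mulHeight₁_eq_exp_absLogHeight₁ {K : IntermediateField ℚ ℂ} [NumberField K] (a : K) :
    mulHeight₁ a = Real.exp (Module.finrank ℚ K * absLogHeight₁ (a : ℂ)) := by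
  have hxint : IsIntegral ℚ (a : ℂ) :=
    (Algebra.IsIntegral.isIntegral (R := ℚ) a).map K.val
  have hle : IntermediateField.adjoin ℚ {(a : ℂ)} ≤ K := by
    rw [IntermediateField.adjoin_le_iff, Set.singleton_subset_iff]
    exact a.2
  have : FiniteDimensional ℚ (IntermediateField.adjoin ℚ {(a : ℂ)}) :=
    IntermediateField.adjoin.finiteDimensional hxint
  have : NumberField (IntermediateField.adjoin ℚ {(a : ℂ)}) := {}
  let : Algebra (IntermediateField.adjoin ℚ {(a : ℂ)}) K :=
    (IntermediateField.inclusion hle).toRingHom.toAlgebra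
  have : IsScalarTower ℚ (IntermediateField.adjoin ℚ {(a : ℂ)}) K :=
    IsScalarTower.of_algebraMap_eq fun x => ((IntermediateField.inclusion hle).commutes x).symm
  set g := IntermediateField.AdjoinSimple.gen ℚ (a : ℂ) with hg
  have hga : algebraMap (IntermediateField.adjoin ℚ {(a : ℂ)}) K g = a := Subtype.ext rfl
  have hpos : (0 : ℝ) < mulHeight₁ g := mulHeight₁_pos g
  have h1 := mulHeight₁_algebraMap (K := K) g
  rw [hga] at h1
  rw [h1, ← Module.finrank_mul_finrank ℚ (IntermediateField.adjoin ℚ {(a : ℂ)}) K,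
    absLogHeight₁, absMulHeight₁, dif_pos hxint, ← hg, Real.log_rpow hpos]
  have hd : (Module.finrank ℚ (IntermediateField.adjoin ℚ {(a : ℂ)}) : ℝ) ≠ 0 := by
    exact_mod_cast Module.finrank_pos.ne'
  push_cast
  rw [mul_comm (Module.finrank ℚ (IntermediateField.adjoin ℚ {(a : ℂ)}) : ℝ), mul_assoc,
    mul_inv_cancel_left₀ hd, ← Real.log_pow, Real.exp_log (pow_pos hpos _)]

end NumberField

/-! ### Values of integer polynomials in two variables -/

/-- The value at `(a, b)` of the polynomial `∑ p i j X ^ i Y ^ j` with integer coefficients and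
partial degrees less than `L`. -/
def bipolyVal {A : Type*} [CommRing A] {L : ℕ} (p : Fin L × Fin L → ℤ) (a b : A) : A :=
  ∑ ij, (p ij : A) * a ^ (ij.1 : ℕ) * b ^ (ij.2 : ℕ)

theorem map_bipolyVal {A B : Type*} [CommRing A] [CommRing B] {L : ℕ} (φ : A →+* B)
    (p : Fin L × Fin L → ℤ) (a b : A) : φ (bipolyVal p a b) = bipolyVal p (φ a) (φ b) := by
  simp [bipolyVal]

theorem bipolyVal_sub {A : Type*} [CommRing A] {L : ℕ} (p q : Fin L × Fin L → ℤ) (a b : A) :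
    bipolyVal (p - q) a b = bipolyVal p a b - bipolyVal q a b := by
  simp [bipolyVal, sub_mul]

theorem pow_mul_pow_le_max_pow {s t : ℝ} (hs : 0 ≤ s) (ht : 0 ≤ t) {i j L : ℕ} (hi : i ≤ L)
    (hj : j ≤ L) : s ^ i * t ^ j ≤ (max s 1 * max t 1) ^ L := by
  rw [mul_pow]
  have h1 : s ^ i ≤ max s 1 ^ L :=
    (pow_le_pow_left₀ hs (le_max_left _ _) i).trans (pow_le_pow_right₀ (le_max_right _ _) hi)
  have h2 : t ^ j ≤ max t 1 ^ L :=
    (pow_le_pow_left₀ ht (le_max_left _ _) j).trans (pow_le_pow_right₀ (le_max_right _ _) hj)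
  gcongr

theorem norm_bipolyVal_le {L : ℕ} {X : ℝ} {p : Fin L × Fin L → ℤ} (hp : ∀ ij, |(p ij : ℝ)| ≤ X)
    (a b : ℂ) : ‖bipolyVal p a b‖ ≤ X * L ^ 2 * (max ‖a‖ 1 * max ‖b‖ 1) ^ L := by
  calc ‖bipolyVal p a b‖ ≤ ∑ ij : Fin L × Fin L, X * (max ‖a‖ 1 * max ‖b‖ 1) ^ L := by
        refine norm_sum_le_of_le _ fun ij _ => ?_
        rw [norm_mul, norm_mul, norm_pow, norm_pow, mul_assoc, Complex.norm_intCast]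
        exact mul_le_mul (hp ij)
          (pow_mul_pow_le_max_pow (norm_nonneg _) (norm_nonneg _) ij.1.2.le ij.2.2.le)
          (by positivity) ((abs_nonneg _).trans (hp ij))
    _ = _ := by
        simp only [Finset.sum_const, Finset.card_univ, Fintype.card_prod, Fintype.card_fin,
          nsmul_eq_mul]
        push_cast
        ring

/-! ### Local bounds and Liouville's inequality -/

namespace NumberField

open Height

variable {K : Type*} [Field K] [NumberField K]

theorem infinitePlace_bipolyVal_le {K : Type*} [Field K] {L : ℕ} {X : ℝ} {p : Fin L × Fin L → ℤ}
    (hp : ∀ ij, |(p ij : ℝ)| ≤ X) (a b : K) (v : InfinitePlace K) :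
    v (bipolyVal p a b) ≤ X * L ^ 2 * (max (v a) 1 * max (v b) 1) ^ L := by
  simp only [← v.norm_embedding_eq, map_bipolyVal]
  exact norm_bipolyVal_le hp _ _

/-- By the ultrametric inequality and |n|_v ≤ 1 for integers n, neither the coefficients nor the
number of terms contributes. -/
theorem finitePlace_bipolyVal_le {L : ℕ} (p : Fin L × Fin L → ℤ) (a b : K) (v : FinitePlace K) :
    v (bipolyVal p a b) ≤ (max (v a) 1 * max (v b) 1) ^ L := by
  have hv : IsNonarchimedean (v ·) := FinitePlace.add_le v
  have hC : (0 : ℝ) ≤ (max (v a) 1 * max (v b) 1) ^ L := by positivity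
  have key : ∀ s : Finset (Fin L × Fin L),
      v (∑ ij ∈ s, (p ij : K) * a ^ (ij.1 : ℕ) * b ^ (ij.2 : ℕ)) ≤
        (max (v a) 1 * max (v b) 1) ^ L := by
    classical
    intro s
    induction s using Finset.induction_on with
    | empty => simp only [Finset.sum_empty, map_zero, hC]
    | insert ij s hs ih =>
      rw [Finset.sum_insert hs]
      refine (hv _ _).trans (max_le ?_ ih)
      show v ((p ij : K) * a ^ (ij.1 : ℕ) * b ^ (ij.2 : ℕ)) ≤ _
      rw [map_mul, map_mul, map_pow, map_pow, mul_assoc]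
      have h1 : v (p ij : K) ≤ 1 := IsNonarchimedean.apply_intCast_le_one hv
      have h2 := pow_mul_pow_le_max_pow (apply_nonneg v a) (apply_nonneg v b)
        ij.1.2.le ij.2.2.le
      exact (mul_le_of_le_one_left
        (mul_nonneg (pow_nonneg (apply_nonneg v a) _) (pow_nonneg (apply_nonneg v b) _)) h1).trans h2
  exact key _

theorem hasFiniteMulSupport_max_one (x : K) :
    (fun v : FinitePlace K => max (v x) 1).HasFiniteMulSupport := by
  rcases eq_or_ne x 0 with rfl | hx
  · simp [Function.HasFiniteMulSupport]
  · exact (FinitePlace.hasFiniteMulSupport hx).max Function.hasFiniteMulSupport_one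

/-- Lower bound for the archimedean part of a nonzero polynomial value. -/
theorem one_le_prod_infinitePlace_bipolyVal {L : ℕ} {p : Fin L × Fin L → ℤ} {a b : K}
    (hx : bipolyVal p a b ≠ 0) :
    1 ≤ (∏ v : InfinitePlace K, v (bipolyVal p a b) ^ v.mult) *
      ((∏ᶠ v : FinitePlace K, max (v a) 1) * ∏ᶠ v : FinitePlace K, max (v b) 1) ^ L := by
  have ha := hasFiniteMulSupport_max_one a
  have hb := hasFiniteMulSupport_max_one b
  have hab : (fun v : FinitePlace K => max (v a) 1 * max (v b) 1).HasFiniteMulSupport := ha.mul hb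
  rw [← finprod_mul_distrib ha hb, finprod_pow hab]
  refine (prod_abs_eq_one hx).symm.le.trans ?_
  refine mul_le_mul_of_nonneg_left ?_
    (Finset.prod_nonneg fun v _ => pow_nonneg (apply_nonneg v _) _)
  exact finprod_le_finprod (FinitePlace.hasFiniteMulSupport hx) (fun v => apply_nonneg v _)
    (hab.pow L) fun v => finitePlace_bipolyVal_le p a b v

/-- The product of the local bounds for a polynomial value is bounded by heights. -/
theorem prod_bounds_eq (L : ℕ) (X : ℝ) (a b : K) :
    (∏ v : InfinitePlace K, (X * (max (v a) 1 * max (v b) 1) ^ L) ^ v.mult) *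
      ((∏ᶠ v : FinitePlace K, max (v a) 1) * ∏ᶠ v : FinitePlace K, max (v b) 1) ^ L =
    X ^ Module.finrank ℚ K * (mulHeight₁ a * mulHeight₁ b) ^ L := by
  rw [mulHeight₁_eq, mulHeight₁_eq, ← InfinitePlace.sum_mult_eq, ← Finset.prod_pow_eq_pow_sum]
  simp only [mul_pow, Finset.prod_mul_distrib, pow_right_comm _ L, Finset.prod_pow]
  ring

/-- **Liouville's inequality** for polynomial values. -/
theorem one_le_norm_bipolyVal_mul {L : ℕ} {X : ℝ} (hX : 1 ≤ X) (hL : 1 ≤ L)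
    {p : Fin L × Fin L → ℤ} (hp : ∀ ij, |(p ij : ℝ)| ≤ X) {a b : K}
    (hx : bipolyVal p a b ≠ 0) (φ : K →+* ℂ) :
    1 ≤ ‖φ (bipolyVal p a b)‖ * ((X * L ^ 2) ^ Module.finrank ℚ K *
      (mulHeight₁ a * mulHeight₁ b) ^ L) := by
  classical
  have hL' : (1 : ℝ) ≤ L := by exact_mod_cast hL
  rw [← prod_bounds_eq]
  set x := bipolyVal p a b with hxdef
  set w := InfinitePlace.mk φ with hw
  have hφ : ‖φ x‖ = w x := rfl
  have hXL : 1 ≤ X * (L : ℝ) ^ 2 := one_le_mul_of_one_le_of_one_le hX (one_le_pow₀ hL')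
  have hB : ∀ v : InfinitePlace K, 1 ≤ X * L ^ 2 * (max (v a) 1 * max (v b) 1) ^ L := fun v =>
    one_le_mul_of_one_le_of_one_le hXL
      (one_le_pow₀ (one_le_mul_of_one_le_of_one_le (le_max_right _ _) (le_max_right _ _)))
  refine (one_le_prod_infinitePlace_bipolyVal hx).trans ?_
  rw [← mul_assoc]
  refine mul_le_mul_of_nonneg_right ?_ ?_
  · rw [← Finset.mul_prod_erase _ _ (Finset.mem_univ w),
      ← Finset.mul_prod_erase _ (fun v : InfinitePlace K => (_ : ℝ)) (Finset.mem_univ w), ← mul_assoc,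
      hφ]
    have hwx : 0 ≤ w x := apply_nonneg w x
    refine mul_le_mul ?_ ?_
      (Finset.prod_nonneg fun v _ => pow_nonneg (apply_nonneg v _) _) ?_
    -- Only one of the `w.mult` factors at w is kept as the norm of φ x. The others are bounded, and
    -- since the bound is at least 1 its exponent may be raised from k to k + 1.
    · obtain ⟨k, hk⟩ : ∃ k, w.mult = k + 1 := Nat.exists_eq_succ_of_ne_zero w.mult_ne_zero
      rw [hk, pow_succ', ← hxdef]
      refine mul_le_mul_of_nonneg_left ?_ hwx
      exact (pow_le_pow_left₀ hwx (infinitePlace_bipolyVal_le hp a b w) k).trans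
        (pow_le_pow_right₀ (hB w) (Nat.le_succ k))
    · exact Finset.prod_le_prod (fun v _ => pow_nonneg (apply_nonneg v _) _)
        fun v _ => pow_le_pow_left₀ (apply_nonneg v _) (infinitePlace_bipolyVal_le hp a b v) _
    · exact mul_nonneg hwx (pow_nonneg (zero_le_one.trans (hB w)) _)
  · exact pow_nonneg (mul_nonneg (finprod_nonneg fun v => by positivity)
      (finprod_nonneg fun v => by positivity)) _

/-! ### Pigeonhole at one point -/

/-- The index of the box containing `t` when `[-W, W]` is divided into `n` equal parts. -/
noncomputable def boxIndex (n : ℕ) (W t : ℝ) : Fin (n + 1) :=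
  Fin.ofNat (n + 1) ⌊(t + W) / (2 * W) * n⌋₊

/-- Rescaling puts both numbers in [0, n], and equal floors force a distance below 1. The endpoint W
has index n, hence n + 1 indices. -/
theorem abs_sub_le_of_boxIndex_eq {n : ℕ} (hn : 1 ≤ n) {W s t : ℝ} (hW : 0 < W) (hs : |s| ≤ W)
    (ht : |t| ≤ W) (h : boxIndex n W s = boxIndex n W t) : |s - t| < 2 * W / n := by
  have hn' : (0 : ℝ) < n := by exact_mod_cast hn
  have aux : ∀ u : ℝ, |u| ≤ W → 0 ≤ (u + W) / (2 * W) * n ∧ ⌊(u + W) / (2 * W) * n⌋₊ < n + 1 := by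
    intro u hu
    obtain ⟨h1, h2⟩ := abs_le.1 hu
    have h0 : 0 ≤ (u + W) / (2 * W) * n :=
      mul_nonneg (div_nonneg (by linarith) (by linarith)) hn'.le
    refine ⟨h0, Nat.lt_succ_of_le (Nat.floor_le_of_le ?_)⟩
    refine mul_le_of_le_one_left hn'.le ?_
    rw [div_le_one (by linarith)]
    linarith
  obtain ⟨s0, s1⟩ := aux s hs
  obtain ⟨t0, t1⟩ := aux t ht
  have h' := congrArg Fin.val h
  simp only [boxIndex, Fin.ofNat, Nat.mod_eq_of_lt s1, Nat.mod_eq_of_lt t1] at h'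
  have hlt : |(s + W) / (2 * W) * n - (t + W) / (2 * W) * n| < 1 := by
    have a1 := Nat.floor_le s0
    have a2 := Nat.lt_floor_add_one ((s + W) / (2 * W) * n)
    have b1 := Nat.floor_le t0
    have b2 := Nat.lt_floor_add_one ((t + W) / (2 * W) * n)
    rw [h'] at a1 a2
    rw [abs_lt]
    constructor <;> linarith
  have heq : (s + W) / (2 * W) * n - (t + W) / (2 * W) * n = (s - t) * (n / (2 * W)) := by
    field_simp
    ring
  rw [heq, abs_mul, abs_of_pos (by positivity : (0 : ℝ) < n / (2 * W))] at hlt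
  rw [lt_div_iff₀ hn']
  rw [← mul_div_assoc, div_lt_one (by positivity)] at hlt
  exact hlt

/-- Polynomials with coefficients in `{0, …, X}` take few values at a given point of `K ^ 2`. -/
theorem exists_coloring {L X n : ℕ} (hL : 1 ≤ L) (hX : 1 ≤ X) (hn : 1 ≤ n) (a b : K)
    (h : ((4 * X * L ^ 2 : ℝ)) ^ Module.finrank ℚ K * (mulHeight₁ a * mulHeight₁ b) ^ L ≤
      (n : ℝ) ^ Module.finrank ℚ K) :
    ∃ c : (Fin L × Fin L → Fin (X + 1)) → Fin ((n + 1) ^ Module.finrank ℚ K),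
      ∀ p q, c p = c q →
        bipolyVal (fun ij => ((p ij : ℕ) : ℤ)) a b = bipolyVal (fun ij => ((q ij : ℕ) : ℤ)) a b := by
  classical
  have hn' : (0 : ℝ) < n := by exact_mod_cast hn
  let val : (Fin L × Fin L → Fin (X + 1)) → K := fun p => bipolyVal (fun ij => ((p ij : ℕ) : ℤ)) a b
  let W : InfinitePlace K → ℝ := fun v => X * L ^ 2 * (max (v a) 1 * max (v b) 1) ^ L
  have hX' : (0 : ℝ) < X := by exact_mod_cast hX
  have hL' : (0 : ℝ) < L := by exact_mod_cast hL
  have hW : ∀ v, 0 < W v := fun v => by positivity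
  have hval : ∀ p (v : InfinitePlace K), ‖v.embedding (val p)‖ ≤ W v := by
    intro p v
    rw [v.norm_embedding_eq]
    refine infinitePlace_bipolyVal_le (fun ij => ?_) a b v
    have : (p ij : ℕ) ≤ X := Nat.lt_succ_iff.1 (p ij).2
    simpa using (by exact_mod_cast this : ((p ij : ℕ) : ℝ) ≤ X)
  -- One real coordinate at a real place and two at a complex place make [K : ℚ] coordinates in all.
  let box : (Fin L × Fin L → Fin (X + 1)) → ((v : InfinitePlace K) → Fin v.mult → Fin (n + 1)) :=
    fun p v i => if (i : ℕ) = 0 then boxIndex n (W v) (v.embedding (val p)).re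
      else boxIndex n (W v) (v.embedding (val p)).im
  have hcard : Fintype.card ((v : InfinitePlace K) → Fin v.mult → Fin (n + 1)) =
      (n + 1) ^ Module.finrank ℚ K := by
    simp [Fintype.card_pi, ← InfinitePlace.sum_mult_eq, Finset.prod_pow_eq_pow_sum]
  refine ⟨fun p => Fintype.equivFinOfCardEq hcard (box p), fun p q hpq => ?_⟩
  have hbox : box p = box q := (Fintype.equivFinOfCardEq hcard).injective hpq
  have hclose : ∀ v : InfinitePlace K, v (val p - val q) < 4 / n * W v := by
    intro v
    have hre : |(v.embedding (val p)).re - (v.embedding (val q)).re| < 2 * W v / n := by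
      refine abs_sub_le_of_boxIndex_eq hn (hW v) ((Complex.abs_re_le_norm _).trans (hval p v))
        ((Complex.abs_re_le_norm _).trans (hval q v)) ?_
      have := congrFun (congrFun hbox v) ⟨0, v.mult_pos⟩
      simpa [box] using this
    have him : |(v.embedding (val p)).im - (v.embedding (val q)).im| < 2 * W v / n := by
      by_cases hv : v.IsReal
      · have hz : ∀ x : K, (v.embedding x).im = 0 := fun x => by
          have := RingHom.congr_fun (InfinitePlace.isReal_iff.1 hv) x
          exact Complex.conj_eq_iff_im.1 this
        rw [hz, hz]
        simpa using div_pos (mul_pos two_pos (hW v)) hn'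
      · refine abs_sub_le_of_boxIndex_eq hn (hW v) ((Complex.abs_im_le_norm _).trans (hval p v))
          ((Complex.abs_im_le_norm _).trans (hval q v)) ?_
        have hm : 1 < v.mult := by simp [InfinitePlace.mult, hv]
        have := congrFun (congrFun hbox v) ⟨1, hm⟩
        simpa [box] using this
    rw [← v.norm_embedding_eq, map_sub]
    refine (Complex.norm_le_abs_re_add_abs_im _).trans_lt ?_
    rw [Complex.sub_re, Complex.sub_im]
    calc _ < 2 * W v / n + 2 * W v / n := add_lt_add hre him
      _ = _ := by ring
  -- A nonzero difference of two values in the same box is too small at every infinite place to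
  -- satisfy the product formula.
  by_contra hne
  have hsub : bipolyVal ((fun ij => ((p ij : ℕ) : ℤ)) - fun ij => ((q ij : ℕ) : ℤ)) a b =
      val p - val q := bipolyVal_sub _ _ _ _
  have hx : bipolyVal ((fun ij => ((p ij : ℕ) : ℤ)) - fun ij => ((q ij : ℕ) : ℤ)) a b ≠ 0 := by
    rw [hsub]
    exact sub_ne_zero.2 hne
  have h1 := one_le_prod_infinitePlace_bipolyVal hx
  rw [hsub] at h1
  have hpos : ∀ x : K, 0 < ∏ᶠ v : FinitePlace K, max (v x) 1 := fun x =>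
    zero_lt_one.trans_le (one_le_finprod fun v => le_max_right _ _)
  have hfin : 0 < ((∏ᶠ v : FinitePlace K, max (v a) 1) * ∏ᶠ v : FinitePlace K, max (v b) 1) ^ L :=
    pow_pos (mul_pos (hpos a) (hpos b)) _
  have h2 : ∏ v : InfinitePlace K, v (val p - val q) ^ v.mult <
      ∏ v : InfinitePlace K, (4 / n * W v) ^ v.mult := by
    refine Finset.prod_lt_prod_of_nonempty (fun v _ => pow_pos ?_ _) (fun v _ => ?_)
      Finset.univ_nonempty
    · rw [← hsub]
      exact InfinitePlace.pos_iff.2 hx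
    · exact pow_lt_pow_left₀ (hclose v) (apply_nonneg v _) v.mult_ne_zero
  have h3 := h1.trans_lt (mul_lt_mul_of_pos_right h2 hfin)
  have hprod := prod_bounds_eq L (4 / n * (X * L ^ 2) : ℝ) a b
  simp only [W, ← mul_assoc] at h3 hprod
  rw [hprod] at h3
  have h4 : (4 / n * X * L ^ 2 : ℝ) = (4 * X * L ^ 2) / n := by ring
  rw [h4, div_pow, div_mul_eq_mul_div, lt_div_iff₀ (by positivity), one_mul] at h3
  exact absurd h h3.not_ge

end NumberField

/-! ### Transfer to the algebraic points of f -/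

open NumberField Height

section AlgPoints

variable {f : ℂ → ℂ} {r N : ℝ} {D : ℕ} {α : ℂ}

theorem exists_numberField_of_mem_algPoints (hα : α ∈ algPoints f r D N) :
    ∃ (K : IntermediateField ℚ ℂ) (_ : NumberField K) (a b : K), (a : ℂ) = α ∧ (b : ℂ) = f α ∧
      Module.finrank ℚ K ≤ D ∧ mulHeight₁ a ≤ Real.exp (N * Module.finrank ℚ K) ∧
      mulHeight₁ b ≤ Real.exp (N * Module.finrank ℚ K) := by
  obtain ⟨-, h1, h2, h3, h4, h5⟩ := hα
  have : FiniteDimensional ℚ (IntermediateField.adjoin ℚ ({α, f α} : Set ℂ)) := by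
    refine IntermediateField.finiteDimensional_adjoin fun x hx => ?_
    rcases hx with rfl | rfl
    · exact h1.isIntegral
    · exact h2.isIntegral
  have hK : NumberField (IntermediateField.adjoin ℚ ({α, f α} : Set ℂ)) := {}
  refine ⟨IntermediateField.adjoin ℚ ({α, f α} : Set ℂ), hK,
    ⟨α, IntermediateField.subset_adjoin _ _ (by simp)⟩,
    ⟨f α, IntermediateField.subset_adjoin _ _ (by simp)⟩, rfl, rfl, h3, ?_, ?_⟩
  · rw [mulHeight₁_eq_exp_absLogHeight₁, mul_comm, Real.exp_le_exp]
    gcongr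
  · rw [mulHeight₁_eq_exp_absLogHeight₁, mul_comm, Real.exp_le_exp]
    gcongr

theorem nonneg_of_mem_algPoints (hα : α ∈ algPoints f r D N) : 0 ≤ N := by
  obtain ⟨K, _, a, b, -, -, -, ha, -⟩ := exists_numberField_of_mem_algPoints hα
  have h := (one_le_mulHeight₁ a).trans ha
  rw [Real.one_le_exp_iff] at h
  have hd : (0 : ℝ) < Module.finrank ℚ K := by exact_mod_cast Module.finrank_pos
  exact nonneg_of_mul_nonneg_left h hd

theorem mulHeight₁_mul_pow_le {K : Type*} [Field K] [NumberField K] {a b : K} {d : ℕ} {N : ℝ}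
    (ha : mulHeight₁ a ≤ Real.exp (N * d)) (hb : mulHeight₁ b ≤ Real.exp (N * d)) (L : ℕ) :
    (mulHeight₁ a * mulHeight₁ b) ^ L ≤ Real.exp (2 * L * N) ^ d := by
  calc (mulHeight₁ a * mulHeight₁ b) ^ L ≤ (Real.exp (N * d) * Real.exp (N * d)) ^ L := by
        gcongr
    _ = _ := by
        rw [← Real.exp_add, ← Real.exp_nat_mul, ← Real.exp_nat_mul]
        ring_nf

/-- The field depends on α, but its degree is at most D, so one set of colours serves all points and
Siegel's pigeonhole can combine them. -/
theorem exists_coloring_of_mem_algPoints (hα : α ∈ algPoints f r D N) {L X n : ℕ} (hL : 1 ≤ L)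
    (hX : 1 ≤ X) (hn : 1 ≤ n) (h : 4 * X * L ^ 2 * Real.exp (2 * L * N) ≤ n) :
    ∃ c : (Fin L × Fin L → Fin (X + 1)) → Fin ((n + 1) ^ D), ∀ p q, c p = c q →
      bipolyVal (fun ij => ((p ij : ℕ) : ℤ)) α (f α) =
        bipolyVal (fun ij => ((q ij : ℕ) : ℤ)) α (f α) := by
  obtain ⟨K, _, a, b, rfl, hb', hD, ha, hb⟩ := exists_numberField_of_mem_algPoints hα
  obtain ⟨c, hc⟩ := exists_coloring hL hX hn a b (by
    calc _ ≤ ((4 * X * L ^ 2 : ℝ)) ^ Module.finrank ℚ K *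
          Real.exp (2 * L * N) ^ Module.finrank ℚ K := by
          gcongr
          exact mulHeight₁_mul_pow_le ha hb L
      _ = (4 * X * L ^ 2 * Real.exp (2 * L * N)) ^ Module.finrank ℚ K := (mul_pow _ _ _).symm
      _ ≤ _ := by gcongr)
  refine ⟨fun p => Fin.castLE (Nat.pow_le_pow_right n.succ_pos hD) (c p), fun p q hpq => ?_⟩
  have := congrArg K.val.toRingHom (hc p q (Fin.castLE_injective _ hpq))
  rw [map_bipolyVal, map_bipolyVal] at this
  rw [← hb']
  exact this

theorem one_le_norm_bipolyVal_mul_of_mem_algPoints (hα : α ∈ algPoints f r D N) {L : ℕ} {X : ℝ}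
    (hL : 1 ≤ L) (hX : 1 ≤ X) {p : Fin L × Fin L → ℤ} (hp : ∀ ij, |(p ij : ℝ)| ≤ X)
    (hne : bipolyVal p α (f α) ≠ 0) :
    1 ≤ ‖bipolyVal p α (f α)‖ * (X * L ^ 2 * Real.exp (2 * L * N)) ^ D := by
  have hN := nonneg_of_mem_algPoints hα
  obtain ⟨K, _, a, b, rfl, hb', hD, ha, hb⟩ := exists_numberField_of_mem_algPoints hα
  have hmap : K.val.toRingHom (bipolyVal p a b) = bipolyVal p (a : ℂ) (f a) := by
    rw [map_bipolyVal, ← hb']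
    rfl
  have hL' : (1 : ℝ) ≤ L := by exact_mod_cast hL
  have hne' : bipolyVal p a b ≠ 0 := fun h0 => hne (by rw [← hmap, h0, map_zero])
  refine (one_le_norm_bipolyVal_mul hX hL hp hne' K.val.toRingHom).trans ?_
  rw [hmap]
  gcongr
  calc _ ≤ (X * L ^ 2) ^ Module.finrank ℚ K * Real.exp (2 * L * N) ^ Module.finrank ℚ K := by
        gcongr
        exact mulHeight₁_mul_pow_le ha hb L
    _ = (X * L ^ 2 * Real.exp (2 * L * N)) ^ Module.finrank ℚ K := (mul_pow _ _ _).symm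
    _ ≤ _ := by
        refine pow_le_pow_right₀ ?_ hD
        exact one_le_mul_of_one_le_of_one_le (one_le_mul_of_one_le_of_one_le hX (one_le_pow₀ hL'))
          (Real.one_le_exp (by positivity))

end AlgPoints

/-! ### Siegel's lemma and extrapolation -/

/-- **Siegel's lemma** for polynomials vanishing at the points `(α, f α)`, `α ∈ S`. -/
theorem exists_bipoly_vanishing {f : ℂ → ℂ} {r N : ℝ} {D L X : ℕ} {S : Finset ℂ}
    (hS : ∀ α ∈ S, α ∈ algPoints f r D N) (hL : 1 ≤ L) (hLS : 2 * (D * S.card) ≤ L ^ 2)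
    (hX : 4 * L ^ 2 * Real.exp (2 * L * N) ≤ X) :
    ∃ p : Fin L × Fin L → ℤ, p ≠ 0 ∧ (∀ ij, |(p ij : ℝ)| ≤ X) ∧
      ∀ α ∈ S, bipolyVal p α (f α) = 0 := by
  classical
  have hL' : (1 : ℝ) ≤ L := by exact_mod_cast hL
  have hXpos : (0 : ℝ) < X := lt_of_lt_of_le (by positivity) hX
  have hX1 : 1 ≤ X := by exact_mod_cast hXpos
  -- With this n the colouring condition is `hX` multiplied by X, and n + 1 < (X + 1)² makes the
  -- colour vectors, (n + 1)^(D|S|) in number, fewer than the (X + 1)^(L²) polynomials.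
  set n := X ^ 2 with hn
  have hn1 : 1 ≤ n := Nat.one_le_pow _ _ hX1
  have hnX : 4 * X * L ^ 2 * Real.exp (2 * L * N) ≤ n := by
    rw [hn]
    push_cast
    nlinarith
  choose c hc using fun α : S => exists_coloring_of_mem_algPoints (hS α α.2) hL hX1 hn1 hnX
  let C : (Fin L × Fin L → Fin (X + 1)) → (S → Fin ((n + 1) ^ D)) := fun p α => c α p
  have hcard : Fintype.card (S → Fin ((n + 1) ^ D)) <
      Fintype.card (Fin L × Fin L → Fin (X + 1)) := by
    simp only [Fintype.card_fun, Fintype.card_fin, Fintype.card_prod, Fintype.card_coe]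
    rw [← pow_mul]
    have hlt : n + 1 < (X + 1) ^ 2 := by rw [hn]; nlinarith
    rcases Nat.eq_zero_or_pos (D * S.card) with h0 | h0
    · rw [h0, pow_zero]
      exact Nat.one_lt_pow (by positivity) (by omega)
    · calc (n + 1) ^ (D * S.card) < ((X + 1) ^ 2) ^ (D * S.card) :=
            Nat.pow_lt_pow_left hlt h0.ne'
        _ = (X + 1) ^ (2 * (D * S.card)) := (pow_mul _ _ _).symm
        _ ≤ (X + 1) ^ (L * L) := Nat.pow_le_pow_right X.succ_pos (by rwa [← sq])
  obtain ⟨p, q, hpq, hCpq⟩ := Fintype.exists_ne_map_eq_of_card_lt C hcard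
  refine ⟨(fun ij => ((p ij : ℕ) : ℤ)) - fun ij => ((q ij : ℕ) : ℤ), ?_, ?_, ?_⟩
  · rw [sub_ne_zero]
    intro h
    refine hpq (funext fun ij => Fin.ext ?_)
    exact_mod_cast congrFun h ij
  · intro ij
    have h1 : ((p ij : ℕ) : ℝ) ≤ X := by exact_mod_cast Nat.lt_succ_iff.1 (p ij).2
    have h2 : ((q ij : ℕ) : ℝ) ≤ X := by exact_mod_cast Nat.lt_succ_iff.1 (q ij).2
    have h3 : (0 : ℝ) ≤ ((p ij : ℕ) : ℝ) := Nat.cast_nonneg _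
    have h4 : (0 : ℝ) ≤ ((q ij : ℕ) : ℝ) := Nat.cast_nonneg _
    simp only [Pi.sub_apply]
    push_cast
    rw [abs_le]
    constructor <;> linarith
  · intro α hα
    rw [bipolyVal_sub, sub_eq_zero]
    exact hc ⟨α, hα⟩ p q (congrFun hCpq ⟨α, hα⟩)

open Metric in
/-- A nonzero integer polynomial in `z` and `f z` has only finitely many zeros in a smaller disc
if `f` is transcendental. -/
theorem finite_zeros_bipolyVal {f : ℂ → ℂ} {R r : ℝ} (hr : 0 < r) (hR : r < R)
    (hf : AnalyticOnNhd ℂ f (ball 0 R)) (hfc : ContinuousOn f (closedBall 0 R))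
    (hft : TranscendentalFunOn f (closedBall 0 R)) {L : ℕ} {p : Fin L × Fin L → ℤ} (hp : p ≠ 0) :
    {z ∈ closedBall (0 : ℂ) r | bipolyVal p z (f z) = 0}.Finite := by
  by_contra hinf
  have hR0 : 0 < R := hr.trans hR
  -- As r < R, the accumulation point lies in the open disc of analyticity. The identity theorem
  -- applies there, and continuity extends the vanishing to the closed disc.
  obtain ⟨z₀, hz₀, hacc⟩ := Set.Infinite.exists_accPt_of_subset_isCompact hinf
    (isCompact_closedBall (0 : ℂ) r) (Set.sep_subset _ _)
  have hz₀R : z₀ ∈ ball (0 : ℂ) R := closedBall_subset_ball hR hz₀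
  have hF : AnalyticOnNhd ℂ (fun z => bipolyVal p z (f z)) (ball 0 R) := by
    unfold bipolyVal
    refine Finset.analyticOnNhd_fun_sum _ fun ij _ => ?_
    exact (analyticOnNhd_const.mul (analyticOnNhd_id.pow _)).mul (hf.pow _)
  have hfreq : ∃ᶠ z in nhdsWithin z₀ {z₀}ᶜ, bipolyVal p z (f z) = 0 := by
    rw [accPt_iff_frequently_nhdsNE] at hacc
    exact hacc.mono fun z hz => hz.2
  have h0 : Set.EqOn (fun z => bipolyVal p z (f z)) 0 (ball 0 R) :=
    hF.eqOn_zero_of_preconnected_of_frequently_eq_zero (convex_ball _ _).isPreconnected hz₀R hfreq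
  have hcont : ContinuousOn (fun z => bipolyVal p z (f z)) (closedBall 0 R) := by
    unfold bipolyVal
    fun_prop
  have h1 : Set.EqOn (fun z => bipolyVal p z (f z)) 0 (closedBall 0 R) :=
    h0.of_subset_closure hcont continuousOn_const ball_subset_closedBall
      (by rw [closure_ball _ hR0.ne'])
  refine hft ⟨∑ ij, MvPolynomial.monomial (Finsupp.single 0 (ij.1 : ℕ) + Finsupp.single 1 (ij.2 : ℕ))
    ((p ij : ℤ) : ℂ), ?_, fun z hz => ?_⟩
  · obtain ⟨ij, hij⟩ := Function.ne_iff.1 hp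
    intro h
    have hco := congrArg
      (MvPolynomial.coeff (Finsupp.single 0 (ij.1 : ℕ) + Finsupp.single 1 (ij.2 : ℕ))) h
    rw [MvPolynomial.coeff_sum, MvPolynomial.coeff_zero, Finset.sum_eq_single ij] at hco
    · rw [MvPolynomial.coeff_monomial, if_pos rfl] at hco
      exact hij (by exact_mod_cast hco)
    · intro kl _ hkl
      rw [MvPolynomial.coeff_monomial, if_neg]
      intro he
      refine hkl (Prod.ext (Fin.ext ?_) (Fin.ext ?_))
      · simpa using DFunLike.congr_fun he 0
      · simpa using DFunLike.congr_fun he 1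
    · simp
  · have := h1 hz
    simp only [bipolyVal, Pi.zero_apply] at this
    rw [map_sum, ← this]
    refine Finset.sum_congr rfl fun ij _ => ?_
    rw [MvPolynomial.eval_monomial, Finsupp.prod_add_index' (by simp) (by intros; rw [pow_add]),
      Finsupp.prod_single_index (by simp), Finsupp.prod_single_index (by simp)]
    simp [mul_assoc]

open Metric in
/-- Large finite sets of algebraic points cannot exist for a whole sequence of parameters
`(D k, N k)` along which extrapolation is possible. -/
theorem false_of_extrapolation {R r c₀ : ℝ} (hr : 0 < r) (hR : r < R)
    (hc₀ : c₀ = Real.log ((R ^ 2 + r ^ 2) / (2 * r * R))) {f : ℂ → ℂ}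
    (hf : AnalyticOnNhd ℂ f (ball 0 R)) (hfc : ContinuousOn f (closedBall 0 R))
    (hft : TranscendentalFunOn f (closedBall 0 R)) {B : ℝ} (hB1 : 1 ≤ B)
    (hB : ∀ z ∈ closedBall (0 : ℂ) R, max ‖z‖ 1 * max ‖f z‖ 1 ≤ B)
    {D : ℕ → ℕ} {N : ℕ → ℝ} {S : ℕ → Finset ℂ} {L X : ℕ}
    (hS : ∀ k, ∀ α ∈ S k, α ∈ algPoints f r (D k) (N k)) (hL : 1 ≤ L)
    (hLS : 2 * (D 0 * (S 0).card) ≤ L ^ 2) (hX : 4 * L ^ 2 * Real.exp (2 * L * N 0) ≤ X)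
    (hcard : Filter.Tendsto (fun k => (S k).card) Filter.atTop Filter.atTop)
    (hext : ∀ k, (D (k + 1)) * (Real.log (X * L ^ 2) + 2 * L * N (k + 1)) +
      Real.log (X * L ^ 2) + L * Real.log B < c₀ * (S k).card) : False := by
  have hR0 : 0 < R := hr.trans hR
  have hL' : (1 : ℝ) ≤ L := by exact_mod_cast hL
  have hXpos : (0 : ℝ) < X := lt_of_lt_of_le (by positivity) hX
  have hX1 : (1 : ℝ) ≤ X := by
    have : 1 ≤ X := by exact_mod_cast hXpos
    exact_mod_cast this
  obtain ⟨p, hp, hpX, hp0⟩ := exists_bipoly_vanishing (hS 0) hL hLS hX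
  have hF : DiffContOnCl ℂ (fun z => bipolyVal p z (f z)) (ball 0 R) := by
    refine ⟨?_, ?_⟩
    · have := hf.differentiableOn
      unfold bipolyVal
      fun_prop
    · rw [closure_ball _ hR0.ne']
      unfold bipolyVal
      fun_prop
  have hM : ∀ z ∈ closedBall (0 : ℂ) R, ‖bipolyVal p z (f z)‖ ≤ X * L ^ 2 * B ^ L := by
    intro z hz
    refine (norm_bipolyVal_le hpX z (f z)).trans ?_
    gcongr
    exact hB z hz
  -- The sets need not be nested: vanishing on S k alone gives vanishing on S (k + 1).
  have hvan : ∀ k, ∀ α ∈ S k, bipolyVal p α (f α) = 0 := by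
    intro k
    induction k with
    | zero => exact hp0
    | succ k ih =>
      intro α hα
      by_contra hne
      have h1 := one_le_norm_bipolyVal_mul_of_mem_algPoints (hS (k + 1) α hα) hL hX1 hpX hne
      have h2 := norm_le_of_vanish_on_finset hr hR (S k) (fun w hw => (hS k w hw).1) hF hM ih
        (hS (k + 1) α hα).1
      have hq : 2 * r * R / (R ^ 2 + r ^ 2) = Real.exp (-c₀) := by
        rw [hc₀, Real.exp_neg, Real.exp_log (by positivity), inv_div]
      have hXL : (0 : ℝ) < X * L ^ 2 := by positivity
      have h3 : (1 : ℝ) ≤ (X * L ^ 2 * B ^ L * Real.exp (-c₀) ^ (S k).card) *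
          (X * L ^ 2 * Real.exp (2 * L * N (k + 1))) ^ D (k + 1) := by
        refine h1.trans ?_
        rw [← hq]
        gcongr
      have h4 := Real.log_nonneg h3
      rw [Real.log_mul (by positivity) (by positivity), Real.log_mul (by positivity) (by positivity),
        Real.log_mul hXL.ne' (by positivity), Real.log_pow, Real.log_pow, Real.log_pow,
        Real.log_mul hXL.ne' (Real.exp_pos _).ne', Real.log_exp, Real.log_exp] at h4
      linarith [hext k]
  have hfin := finite_zeros_bipolyVal hr hR hf hfc hft hp
  obtain ⟨k, hk⟩ := (hcard.eventually_gt_atTop hfin.toFinset.card).exists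
  refine hk.not_ge (Finset.card_le_card fun α hα => ?_)
  rw [Set.Finite.mem_toFinset]
  exact ⟨mem_closedBall_zero_iff.2 (hS k α hα).1, hvan k α hα⟩

/-! ### Choice of the parameters -/

/-- Infinite and large finite sets are treated alike. The exact cardinality matters: too many points
in the initial set would force L to be too large. -/
theorem exists_finset_card_eq_ceil {A : Set ℂ} {t : ℝ} (h : ¬ (A.Finite ∧ (A.ncard : ℝ) < t)) :
    ∃ S : Finset ℂ, (∀ α ∈ S, α ∈ A) ∧ S.card = ⌈t⌉₊ := by
  by_cases hA : A.Finite
  · have hle : ⌈t⌉₊ ≤ hA.toFinset.card := by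
      rw [← Set.ncard_eq_toFinset_card A hA]
      exact Nat.ceil_le.2 (not_lt.1 fun hlt => h ⟨hA, hlt⟩)
    obtain ⟨S, hS, hc⟩ := Finset.exists_subset_card_eq hle
    exact ⟨S, fun α hα => hA.mem_toFinset.1 (hS hα), hc⟩
  · obtain ⟨S, hS, hc⟩ := Set.Infinite.exists_subset_card_eq hA ⌈t⌉₊
    exact ⟨S, fun α hα => hS hα, hc⟩

theorem tendsto_natCeil_atTop_of_le {ε : ℝ} (hε : 0 < ε) {u : ℕ → ℝ} (h : ∀ k : ℕ, ε * k ≤ u k) :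
    Filter.Tendsto (fun k => ⌈u k⌉₊) Filter.atTop Filter.atTop :=
  tendsto_nat_ceil_atTop.comp (Filter.tendsto_atTop_mono h
    (tendsto_natCast_atTop_atTop.const_mul_atTop hε))

/-- For m points take L = ⌈√(2Dm)⌉, the least degree Siegel's lemma allows. The constant 3 absorbs
both roundings: 2D from m and 1 ≤ D from L. -/
theorem exists_degree {δ : ℝ} (hδ : 0 < δ) {D : ℕ} (hD : 1 ≤ D) {N : ℝ} (hN : 0 < N) :
    ∃ L : ℕ, 1 ≤ L ∧ 2 * (D * ⌈δ * (D : ℝ) ^ 3 * N ^ 2⌉₊) ≤ L ^ 2 ∧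
      √(2 * δ) * D ^ 2 * N ≤ L ∧ (L : ℝ) ≤ D * (√(2 * δ) * (N * D) + 3) := by
  have hD' : (1 : ℝ) ≤ D := by exact_mod_cast hD
  set m := ⌈δ * (D : ℝ) ^ 3 * N ^ 2⌉₊ with hm
  have hm1 : δ * (D : ℝ) ^ 3 * N ^ 2 ≤ m := Nat.le_ceil _
  have hm2 : (m : ℝ) < δ * (D : ℝ) ^ 3 * N ^ 2 + 1 := Nat.ceil_lt_add_one (by positivity)
  have hm0 : (0 : ℝ) < m := lt_of_lt_of_le (by positivity) hm1
  have hs : 0 < √(2 * δ) := Real.sqrt_pos.2 (by positivity)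
  have hs2 : √(2 * δ) ^ 2 = 2 * δ := Real.sq_sqrt (by positivity)
  have hle : √(2 * (D * m)) ≤ (⌈√(2 * (D * m))⌉₊ : ℝ) := Nat.le_ceil _
  refine ⟨⌈√(2 * (D * m))⌉₊, ?_, ?_, ?_, ?_⟩
  · exact Nat.one_le_iff_ne_zero.2 (Nat.ceil_pos.2 (Real.sqrt_pos.2 (by positivity))).ne'
  · have h2 : (2 * (D * m) : ℝ) ≤ (⌈√(2 * (D * m))⌉₊ : ℝ) ^ 2 :=
      (Real.sqrt_le_left (by positivity)).1 hle
    exact_mod_cast h2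
  · refine le_trans (Real.le_sqrt_of_sq_le ?_) hle
    calc (√(2 * δ) * D ^ 2 * N) ^ 2 = √(2 * δ) ^ 2 * D ^ 4 * N ^ 2 := by ring
      _ = 2 * (D * (δ * (D : ℝ) ^ 3 * N ^ 2)) := by rw [hs2]; ring
      _ ≤ _ := by gcongr
  · have h1 : (⌈√(2 * (D * m))⌉₊ : ℝ) ≤ √(2 * (D * m)) + 1 :=
      (Nat.ceil_lt_add_one (Real.sqrt_nonneg _)).le
    have h2 : √(2 * (D * m)) ≤ √(2 * δ) * D ^ 2 * N + 2 * D := by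
      rw [Real.sqrt_le_left (by positivity)]
      calc (2 * (D * m) : ℝ) ≤ 2 * (D * (δ * (D : ℝ) ^ 3 * N ^ 2 + 1)) := by gcongr
        _ = √(2 * δ) ^ 2 * D ^ 4 * N ^ 2 + 2 * D := by rw [hs2]; ring
        _ ≤ √(2 * δ) ^ 2 * D ^ 4 * N ^ 2 + 4 * D ^ 2 + 4 * (√(2 * δ) * D ^ 3 * N) := by
            have : 0 ≤ √(2 * δ) * D ^ 3 * N := by positivity
            nlinarith
        _ = _ := by ring
    nlinarith

theorem log_ceil_mul_sq_le {L : ℕ} (hL : 1 ≤ L) {N : ℝ} (hN : 0 ≤ N) :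
    Real.log (⌈4 * (L : ℝ) ^ 2 * Real.exp (2 * L * N)⌉₊ * (L : ℝ) ^ 2) ≤
      2 * L * N + 4 * Real.log L + 3 := by
  have hL' : (1 : ℝ) ≤ L := by exact_mod_cast hL
  set y := 4 * (L : ℝ) ^ 2 * Real.exp (2 * L * N) with hy
  have hy1 : 1 ≤ y := by
    have h1 : 1 ≤ Real.exp (2 * L * N) := Real.one_le_exp (by positivity)
    have h2 : (1 : ℝ) ≤ (L : ℝ) ^ 2 := one_le_pow₀ hL'
    rw [hy]
    nlinarith
  have hX : (⌈y⌉₊ : ℝ) ≤ 2 * y := by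
    have := Nat.ceil_lt_add_one (zero_le_one.trans hy1)
    linarith
  have hXpos : (0 : ℝ) < ⌈y⌉₊ := by
    exact_mod_cast Nat.ceil_pos.2 (zero_lt_one.trans_le hy1)
  calc Real.log (⌈y⌉₊ * (L : ℝ) ^ 2) ≤ Real.log (2 * y * (L : ℝ) ^ 2) := by
        refine Real.log_le_log (by positivity) ?_
        gcongr
    _ = Real.log (2 ^ 3 * ((L : ℝ) ^ 4 * Real.exp (2 * L * N))) := by
        rw [hy]; ring_nf
    _ = 3 * Real.log 2 + (4 * Real.log L + 2 * L * N) := by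
        rw [Real.log_mul (by positivity) (by positivity), Real.log_mul (by positivity)
          (by positivity), Real.log_exp, Real.log_pow, Real.log_pow]
        push_cast
        ring
    _ ≤ _ := by linarith [Real.log_two_lt_d9]

/-- The M₀M terms have coefficients 6s and κ. Since 1 ≤ M₀ ≤ M, the remaining terms are at most (st
+ 18 + 3t)M, which the gap (κ - 6s)M₀M exceeds once M₀ is large. It is used with s = √(2δ), κ = c₀δ,
and M equal to N or ND. -/
theorem exists_threshold {s κ t : ℝ} (hs : 0 < s) (h : 6 * s < κ) (ht : 0 ≤ t) :
    ∃ M₁ : ℝ, 0 < M₁ ∧ ∀ M₀, M₁ ≤ M₀ → ∀ M, M₀ ≤ M →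
      (s * M₀ + 3) * (6 * M + t) < κ * M₀ * M := by
  have hg : 0 < κ - 6 * s := by linarith
  refine ⟨max 1 ((s * t + 18 + 3 * t + 1) / (κ - 6 * s)), by positivity, fun M₀ hM₀ M hM => ?_⟩
  have h1 : 1 ≤ M₀ := (le_max_left _ _).trans hM₀
  have h2 : s * t + 18 + 3 * t + 1 ≤ M₀ * (κ - 6 * s) :=
    (div_le_iff₀ hg).1 ((le_max_right _ _).trans hM₀)
  have h3 : (s * t + 18 + 3 * t + 1) * M ≤ M₀ * (κ - 6 * s) * M :=
    mul_le_mul_of_nonneg_right h2 (by linarith)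
  have h4 : s * t * M₀ ≤ s * t * M := by gcongr
  have h5 : 3 * t ≤ 3 * t * M := by nlinarith
  nlinarith

/-! ### The two sequences -/

section

open Metric Filter

variable {R r c₀ δ : ℝ} {f : ℂ → ℂ}

/-- For fixed `D`, the bound holds for some arbitrarily large `N`. -/
theorem exists_height_ge (hr : 0 < r) (hR : r < R)
    (hc₀ : c₀ = Real.log ((R ^ 2 + r ^ 2) / (2 * r * R))) (hc₀' : 0 < c₀) (hδ : 0 < δ)
    (hδc : 6 * √(2 * δ) < c₀ * δ)
    (hf : AnalyticOnNhd ℂ f (ball 0 R)) (hfc : ContinuousOn f (closedBall 0 R))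
    (hft : TranscendentalFunOn f (closedBall 0 R)) {B : ℝ} (hB1 : 1 ≤ B)
    (hB : ∀ z ∈ closedBall (0 : ℂ) R, max ‖z‖ 1 * max ‖f z‖ 1 ≤ B)
    {D : ℕ} (hD : 1 ≤ D) (N₁ : ℝ) :
    ∃ N, N₁ ≤ N ∧ (algPoints f r D N).Finite ∧
      ((algPoints f r D N).ncard : ℝ) < δ * (D : ℝ) ^ 3 * N ^ 2 := by
  by_contra! hbad
  have hD' : (1 : ℝ) ≤ D := by exact_mod_cast hD
  have hC : 0 ≤ Real.log B := Real.log_nonneg hB1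
  have hs : 0 < √(2 * δ) := Real.sqrt_pos.2 (by positivity)
  -- Here 16 = 7 + 7 + 2: the logarithmic size E ≤ L(2N₀ + 7) is counted twice, and passing from N
  -- to N + 1 adds 2.
  obtain ⟨M₁, hM₁, hM⟩ := exists_threshold hs hδc (by positivity : 0 ≤ 16 + Real.log B)
  set N₀ := max 1 (max N₁ M₁) with hN₀
  have hN₀1 : 1 ≤ N₀ := le_max_left _ _
  have hN₀N : N₁ ≤ N₀ := (le_max_left _ _).trans (le_max_right _ _)
  have hN₀M : M₁ ≤ N₀ := (le_max_right _ _).trans (le_max_right _ _)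
  choose S hS hcard using fun k : ℕ => exists_finset_card_eq_ceil
    (A := algPoints f r D (N₀ + k)) (t := δ * (D : ℝ) ^ 3 * (N₀ + k) ^ 2)
    (fun h => (hbad (N₀ + k) (by linarith [(Nat.cast_nonneg k : (0 : ℝ) ≤ k)]) h.1).not_gt h.2)
  obtain ⟨L, hL1, hL2, -, hL4⟩ := exists_degree hδ hD (zero_lt_one.trans_le hN₀1)
  have hL' : (1 : ℝ) ≤ L := by exact_mod_cast hL1
  have hLD : (L : ℝ) ≤ D ^ 2 * (√(2 * δ) * N₀ + 3) := by
    refine hL4.trans ?_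
    have : (D : ℝ) * 3 ≤ D ^ 2 * 3 := by nlinarith
    nlinarith
  have hE := log_ceil_mul_sq_le hL1 (zero_le_one.trans hN₀1)
  refine false_of_extrapolation hr hR hc₀ hf hfc hft hB1 hB (D := fun _ => D)
    (N := fun k => N₀ + k) (S := S) (L := L)
    (X := ⌈4 * (L : ℝ) ^ 2 * Real.exp (2 * L * N₀)⌉₊) hS hL1 ?_ ?_ ?_ ?_
  · simpa [hcard] using hL2
  · simpa using Nat.le_ceil _
  · simp only [hcard]
    refine tendsto_natCeil_atTop_of_le hδ fun k => ?_
    have hk : (0 : ℝ) ≤ k := Nat.cast_nonneg k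
    have h1 : (k : ℝ) ≤ (D : ℝ) ^ 3 * (N₀ + k) ^ 2 := by
      calc (k : ℝ) ≤ N₀ + k := by linarith
        _ ≤ (N₀ + k) ^ 2 := by nlinarith
        _ ≤ _ := le_mul_of_one_le_left (by positivity) (one_le_pow₀ hD')
    rw [mul_assoc]
    gcongr
  · intro k
    have hk : (0 : ℝ) ≤ k := Nat.cast_nonneg k
    rw [hcard]
    have hm : δ * (D : ℝ) ^ 3 * (N₀ + k) ^ 2 ≤ ⌈δ * (D : ℝ) ^ 3 * (N₀ + k) ^ 2⌉₊ := Nat.le_ceil _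
    have hlog : Real.log L ≤ L := (Real.log_le_sub_one_of_pos (by linarith)).trans (by linarith)
    set E := Real.log (⌈4 * (L : ℝ) ^ 2 * Real.exp (2 * L * N₀)⌉₊ * (L : ℝ) ^ 2)
    set N := N₀ + (k : ℝ) with hN
    have hNN : N₀ ≤ N := by linarith
    have hEL : E ≤ L * (2 * N₀ + 7) := by linarith
    have hkey := hM N₀ hN₀M N hNN
    push_cast
    calc (D : ℝ) * (E + 2 * L * (N₀ + (k + 1))) + E + L * Real.log B
        ≤ D * (L * (2 * N₀ + 7) + 2 * L * (N + 1)) + D * (L * (2 * N₀ + 7)) +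
          D * (L * Real.log B) := by
          have e1 : E ≤ D * (L * (2 * N₀ + 7)) :=
            hEL.trans (le_mul_of_one_le_left (by positivity) hD')
          have e2 : L * Real.log B ≤ D * (L * Real.log B) :=
            le_mul_of_one_le_left (by positivity) hD'
          have e3 : (D : ℝ) * (E + 2 * L * (N₀ + (k + 1))) ≤
              D * (L * (2 * N₀ + 7) + 2 * L * (N + 1)) := by
            rw [hN, add_assoc]
            gcongr
          linarith
      _ = D * L * (4 * N₀ + 2 * N + (16 + Real.log B)) := by ring
      _ ≤ D * (D ^ 2 * (√(2 * δ) * N₀ + 3)) * (6 * N + (16 + Real.log B)) := by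
          gcongr ?_ * ?_
          · gcongr
          · linarith
      _ = D ^ 3 * ((√(2 * δ) * N₀ + 3) * (6 * N + (16 + Real.log B))) := by ring
      _ < D ^ 3 * (c₀ * δ * N₀ * N) := by gcongr
      _ ≤ D ^ 3 * (c₀ * δ * N * N) := by gcongr
      _ = c₀ * (δ * D ^ 3 * N ^ 2) := by ring
      _ ≤ _ := by gcongr

theorem exists_forall_log_le {η : ℝ} (hη : 0 < η) :
    ∃ L₀ : ℝ, ∀ L : ℝ, L₀ ≤ L → 4 * Real.log L + 3 ≤ η * L := by
  have h1 := Real.isLittleO_log_id_atTop.bound (show (0 : ℝ) < η / 8 by positivity)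
  obtain ⟨L₀, hL₀⟩ := eventually_atTop.1
    (h1.and (eventually_ge_atTop (max 1 (6 / η))))
  refine ⟨L₀, fun L hL => ?_⟩
  obtain ⟨h2, h3⟩ := hL₀ L hL
  have h4 : 1 ≤ L := (le_max_left _ _).trans h3
  have h5 : 6 ≤ L * η := (div_le_iff₀ hη).1 ((le_max_right _ _).trans h3)
  have h6 : Real.log L ≤ η / 8 * L := by
    refine (le_abs_self _).trans ?_
    simpa [abs_of_pos (zero_lt_one.trans_le h4)] using h2
  linarith

/-- For fixed `N`, the bound holds for some arbitrarily large `D`. -/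
theorem exists_degree_ge (hr : 0 < r) (hR : r < R)
    (hc₀ : c₀ = Real.log ((R ^ 2 + r ^ 2) / (2 * r * R))) (hc₀' : 0 < c₀) (hδ : 0 < δ)
    (hδc : 6 * √(2 * δ) < c₀ * δ)
    (hf : AnalyticOnNhd ℂ f (ball 0 R)) (hfc : ContinuousOn f (closedBall 0 R))
    (hft : TranscendentalFunOn f (closedBall 0 R)) {B : ℝ} (hB1 : 1 ≤ B)
    (hB : ∀ z ∈ closedBall (0 : ℂ) R, max ‖z‖ 1 * max ‖f z‖ 1 ≤ B)
    {N : ℝ} (hN : 0 < N) (D₁ : ℕ) :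
    ∃ D, D₁ ≤ D ∧ (algPoints f r D N).Finite ∧
      ((algPoints f r D N).ncard : ℝ) < δ * (D : ℝ) ^ 3 * N ^ 2 := by
  by_contra! hbad
  have hC : 0 ≤ Real.log B := Real.log_nonneg hB1
  have hs : 0 < √(2 * δ) := Real.sqrt_pos.2 (by positivity)
  obtain ⟨M₁, hM₁, hM⟩ := exists_threshold hs hδc (by positivity : 0 ≤ 10 * N + Real.log B)
  -- N is fixed and possibly small, so the error 4 log L + 3 is absorbed into 2NL by taking L large.
  -- Then E ≤ 4NL, and (D + 1)(E + 2LN) + E ≤ L(6ND + 10N).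
  obtain ⟨L₀, hL₀⟩ := exists_forall_log_le (by positivity : 0 < 2 * N)
  obtain ⟨D₀, hD₀1, hD₀D, hD₀M, hD₀L⟩ : ∃ D₀ : ℕ, 1 ≤ D₀ ∧ D₁ ≤ D₀ ∧ M₁ ≤ N * D₀ ∧
      L₀ ≤ √(2 * δ) * N * D₀ := by
    have hD : Tendsto (fun D : ℕ => (D : ℝ)) atTop atTop := tendsto_natCast_atTop_atTop
    exact ((eventually_ge_atTop 1).and ((eventually_ge_atTop D₁).and
      (((hD.const_mul_atTop hN).eventually_ge_atTop M₁).and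
        ((hD.const_mul_atTop (mul_pos hs hN)).eventually_ge_atTop L₀)))).exists
  have hD₀' : (1 : ℝ) ≤ D₀ := by exact_mod_cast hD₀1
  choose S hS hcard using fun k : ℕ => exists_finset_card_eq_ceil
    (A := algPoints f r (D₀ + k) N) (t := δ * ((D₀ + k : ℕ) : ℝ) ^ 3 * N ^ 2)
    (fun h => (hbad (D₀ + k) (by omega) h.1).not_gt h.2)
  obtain ⟨L, hL1, hL2, hL3, hL4⟩ := exists_degree hδ hD₀1 hN
  have hL' : (1 : ℝ) ≤ L := by exact_mod_cast hL1
  have hE := log_ceil_mul_sq_le hL1 hN.le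
  have hlog : 4 * Real.log L + 3 ≤ 2 * N * L := by
    refine hL₀ L (hD₀L.trans (le_trans ?_ hL3))
    have : (D₀ : ℝ) ≤ D₀ ^ 2 := by nlinarith
    calc √(2 * δ) * N * D₀ ≤ √(2 * δ) * N * D₀ ^ 2 := by gcongr
      _ = _ := by ring
  refine false_of_extrapolation hr hR hc₀ hf hfc hft hB1 hB (D := fun k => D₀ + k)
    (N := fun _ => N) (S := S) (L := L)
    (X := ⌈4 * (L : ℝ) ^ 2 * Real.exp (2 * L * N)⌉₊) hS hL1 ?_ ?_ ?_ ?_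
  · simpa [hcard] using hL2
  · exact Nat.le_ceil _
  · simp only [hcard]
    refine tendsto_natCeil_atTop_of_le (mul_pos hδ (pow_pos hN 2)) fun k => ?_
    have hk : (0 : ℝ) ≤ k := Nat.cast_nonneg k
    have h1 : (k : ℝ) ≤ ((D₀ + k : ℕ) : ℝ) ^ 3 := by
      push_cast
      calc (k : ℝ) ≤ D₀ + k := by linarith
        _ ≤ (D₀ + k : ℝ) ^ 3 := le_self_pow₀ (by linarith) (by norm_num)
    calc δ * N ^ 2 * k ≤ δ * N ^ 2 * ((D₀ + k : ℕ) : ℝ) ^ 3 := by gcongr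
      _ = _ := by ring
  · intro k
    have hk : (0 : ℝ) ≤ k := Nat.cast_nonneg k
    rw [hcard]
    have hm : δ * ((D₀ + k : ℕ) : ℝ) ^ 3 * N ^ 2 ≤ ⌈δ * ((D₀ + k : ℕ) : ℝ) ^ 3 * N ^ 2⌉₊ :=
      Nat.le_ceil _
    set E := Real.log (⌈4 * (L : ℝ) ^ 2 * Real.exp (2 * L * N)⌉₊ * (L : ℝ) ^ 2)
    have hcast : ((D₀ + (k + 1) : ℕ) : ℝ) = ((D₀ + k : ℕ) : ℝ) + 1 := by push_cast; ring
    have hDD : (D₀ : ℝ) ≤ ((D₀ + k : ℕ) : ℝ) := by push_cast; linarith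
    rw [hcast]
    generalize ((D₀ + k : ℕ) : ℝ) = D at *
    have hEL : E ≤ 4 * N * L := by linarith
    have hkey := hM (N * D₀) hD₀M (N * D) (by gcongr)
    calc (D + 1) * (E + 2 * L * N) + E + L * Real.log B
        ≤ (D + 1) * (4 * N * L + 2 * L * N) + 4 * N * L + L * Real.log B := by
          have : 0 ≤ D + 1 := by linarith
          gcongr
      _ = L * (6 * (N * D) + (10 * N + Real.log B)) := by ring
      _ ≤ (D₀ * (√(2 * δ) * (N * D₀) + 3)) * (6 * (N * D) + (10 * N + Real.log B)) := by
          have : 0 ≤ D := by linarith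
          gcongr
      _ = D₀ * ((√(2 * δ) * (N * D₀) + 3) * (6 * (N * D) + (10 * N + Real.log B))) := by ring
      _ < D₀ * (c₀ * δ * (N * D₀) * (N * D)) := by gcongr
      _ = c₀ * (δ * (D₀ ^ 2 * D) * N ^ 2) := by ring
      _ ≤ c₀ * (δ * (D ^ 2 * D) * N ^ 2) := by
          have : 0 ≤ D := by linarith
          gcongr
      _ = c₀ * (δ * D ^ 3 * N ^ 2) := by ring
      _ ≤ _ := by gcongr

end

theorem mainTheorem2 (R r c₀ δ : ℝ) (hr : 0 < r) (hR : r < R)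
    (hc₀ : c₀ = Real.log ((R ^ 2 + r ^ 2) / (2 * r * R)))
    (hδ : 2 * (6 / c₀) ^ 2 < δ)
    (f : ℂ → ℂ) (hf : AnalyticOnNhd ℂ f (Metric.ball 0 R))
    (hfc : ContinuousOn f (Metric.closedBall 0 R))
    (hft : TranscendentalFunOn f (Metric.closedBall 0 R)) :
    (∀ D : ℕ, 1 ≤ D → ∃ N : ℕ → ℝ,
      (∀ k, 0 ≤ N k) ∧ Filter.Tendsto N Filter.atTop Filter.atTop ∧
      ∀ k, (algPoints f r D (N k)).Finite ∧
        ((algPoints f r D (N k)).ncard : ℝ) < δ * (D : ℝ) ^ 3 * (N k) ^ 2) ∧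
    (∀ N : ℝ, 0 < N → ∃ D : ℕ → ℕ,
      (∀ k, 2 ≤ D k) ∧ Filter.Tendsto D Filter.atTop Filter.atTop ∧
      ∀ k, (algPoints f r (D k) N).Finite ∧
        ((algPoints f r (D k) N).ncard : ℝ) < δ * (D k : ℝ) ^ 3 * N ^ 2) := by
  have hR0 : 0 < R := hr.trans hR
  have hc₀' : 0 < c₀ := by
    rw [hc₀]
    refine Real.log_pos ?_
    rw [one_lt_div (by positivity)]
    nlinarith [mul_pos (sub_pos.2 hR) (sub_pos.2 hR)]
  have hδ0 : 0 < δ := lt_of_le_of_lt (by positivity) hδ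
  -- Squaring turns this into 72 < δ c₀², which is the hypothesis on δ.
  have hδc : 6 * √(2 * δ) < c₀ * δ := by
    have h72 : 72 < δ * c₀ ^ 2 := by
      have : 2 * (6 / c₀) ^ 2 = 72 / c₀ ^ 2 := by field_simp; norm_num
      rw [this, div_lt_iff₀ (by positivity)] at hδ
      exact hδ
    refine lt_of_pow_lt_pow_left₀ 2 (by positivity) ?_
    rw [mul_pow, Real.sq_sqrt (by positivity)]
    nlinarith
  obtain ⟨C, hC⟩ := (isCompact_closedBall (0 : ℂ) R).exists_bound_of_continuousOn hfc
  have hB1 : 1 ≤ max R 1 * max C 1 :=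
    one_le_mul_of_one_le_of_one_le (le_max_right _ _) (le_max_right _ _)
  have hB : ∀ z ∈ Metric.closedBall (0 : ℂ) R,
      max ‖z‖ 1 * max ‖f z‖ 1 ≤ max R 1 * max C 1 := by
    intro z hz
    have h1 := mem_closedBall_zero_iff.1 hz
    have h2 := hC z hz
    gcongr
  constructor
  · intro D hD
    choose N hN hfin using fun k : ℕ =>
      exists_height_ge hr hR hc₀ hc₀' hδ0 hδc hf hfc hft hB1 hB hD (k : ℝ)
    exact ⟨N, fun k => (Nat.cast_nonneg k).trans (hN k),
      Filter.tendsto_atTop_mono hN tendsto_natCast_atTop_atTop, hfin⟩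
  · intro N hN
    choose D hD hfin using fun k : ℕ =>
      exists_degree_ge hr hR hc₀ hc₀' hδ0 hδc hf hfc hft hB1 hB hN (k + 2)
    exact ⟨D, fun k => (Nat.le_add_left 2 k).trans (hD k),
      Filter.tendsto_atTop_mono (fun k => (Nat.le_add_right k 2).trans (hD k)) Filter.tendsto_id,
      hfin⟩
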